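/- For a real number $x$ and $v>0$ put $$\Psi(x,v)=\sum_{1\le n\le v}\frac{\sin(2\pi n^2x)\cot(\pi nx)}{n^2},$$ and let $\Psi(x)=\lim_{v\to\infty}\Psi(x,v)$ whenever this limit exists (we then say that the series $\Psi(x)=\sum_{n\ge1}\frac{\sin(2\pi n^2x)\cot(\pi nx)}{n^2}$ converges). For irrational $x$ let $\alpha_0(x)=\{x\}$ be the fractional part of $x$, $\alpha_{k+1}(x)=\{1/\alpha_k(x)\}$, $\beta_{-1}(x)=1$ and $\beta_k(x)=\alpha_0(x)\alpha_1(x)\cdots\alpha_k(x)$. For a real function $g$ on $(0,1)$ let $$\mathcal S_g(x)=\sum_{j\ge0}\beta_{j-1}(x)\,g(\alpha_j(x)),$$ and let $\Phi=\mathcal S_{\log(1/\cdot)}$, i.e. $\Phi(x)=\sum_{k\ge0}\beta_{k-1}(x)\log(1/\alpha_k(x))\in[0,\infty]$, be the Brjuno function. An irrational $x$ is called a Brjuno number if $\Phi(x)<\infty$. For irrational $x\in(0,1)$ and $v>0$ put $$G(x,v)=\Psi(x,v)-x\,\Psi(1/x,xv)-\frac1{\pi x}\sum_{1\le m\le v}\frac{\sin(2\pi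 m^2x)}{m^3},\qquad G(x)=\lim_{v\to\infty}G(x,v),$$ $$H(x)=\frac1{\pi x}\sum_{m\ge1}\frac{\sin(2\pi m^2x)}{m^3}-\log(1/x).$$ Then: 1. For every irrational $x$, the series $\Psi(x)$ converges if and only if $x$ is a Brjuno number. 2. The limit $G(x)$ exists for every irrational $x\in(0,1)$; the series $\mathcal S_{H+G}(x)$ converges (absolutely) for every irrational $x$, and its sum is a bounded function of the irrational number $x$. 3. For every Brjuno number $x$, $\Psi(x)-\mathcal S_{H+G}(x)=\Phi(x)$. In particular $\Psi-\Phi$ is bounded on the set of Brjuno numbers. -/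

import Mathlib

open Filter Topology Set

namespace RivoalRoques

noncomputable section

/-- The Gauss map `y ↦ {1/y}`. -/
def gaussMap (y : ℝ) : ℝ := Int.fract (1 / y)

/-- The iterates `α_k(x)` of the Gauss map, started at `α_0(x) = {x}`
(which is `x` itself for `0 < x < 1`). -/
def alpha (k : ℕ) (x : ℝ) : ℝ := gaussMap^[k] (Int.fract x)

/-- The product `α_0(x) α_1(x) ⋯ α_{k-1}(x)`, usually written `β_{k-1}(x)`;
its value at `k = 0` is `β_{-1}(x) = 1`. -/
def betaPrev (k : ℕ) (x : ℝ) : ℝ := ∏ i ∈ Finset.range k, alpha i x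

/-- The `j`-th term `β_{j-1}(x) g(α_j(x))` of the series `𝒮_g(x)` with `θ = s = 1`,
for irrational `x`. -/
def seriesTerm (g : ℝ → ℝ) (x : ℝ) (j : ℕ) : ℝ := betaPrev j x * g (alpha j x)

/-- The sum `𝒮_g(x) = ∑_{j ≥ 0} β_{j-1}(x) g(α_j(x))`, for irrational `x`. -/
def seriesSum (g : ℝ → ℝ) (x : ℝ) : ℝ := ∑' j, seriesTerm g x j

/-- The function `log (1/y)`. -/
def logInv (y : ℝ) : ℝ := Real.log (1 / y)

/-- A Brjuno number: an irrational `x` such that the series (of nonnegative terms)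
`Φ(x) = ∑_{k ≥ 0} β_{k-1}(x) log(1/α_k(x))` is finite. -/
def IsBrjuno (x : ℝ) : Prop := Irrational x ∧ Summable (seriesTerm logInv x)

/-- The Brjuno function `Φ(x) = ∑_{k ≥ 0} β_{k-1}(x) log(1/α_k(x))`. -/
def Phi (x : ℝ) : ℝ := seriesSum logInv x

/-- The partial sum `Ψ(x, v) = ∑_{1 ≤ n ≤ v} sin(2πn²x) cot(πnx) / n²`. -/
def psiPartial (x v : ℝ) : ℝ :=
  ∑ n ∈ Finset.Icc 1 ⌊v⌋₊,
    Real.sin (2 * Real.pi * (n : ℝ) ^ 2 * x) * Real.cot (Real.pi * (n : ℝ) * x) / (n : ℝ) ^ 2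

/-- Convergence of the series `Ψ(x)`, in the sense of its partial sums. -/
def PsiConverges (x : ℝ) : Prop := ∃ l : ℝ, Tendsto (psiPartial x) atTop (𝓝 l)

/-- The sum `Ψ(x)` of the series, when it converges. -/
def Psi (x : ℝ) : ℝ := limUnder atTop (psiPartial x)

/-- The remainder `G(x, v)` of the approximate functional equation
`Ψ(x, v) - x Ψ(1/x, xv) = (1/(πx)) ∑_{1 ≤ m ≤ v} sin(2πm²x)/m³ + G(x, v)`. -/
def GPartial (x v : ℝ) : ℝ :=
  psiPartial x v - x * psiPartial (1 / x) (x * v) -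
    1 / (Real.pi * x) *
      ∑ m ∈ Finset.Icc 1 ⌊v⌋₊, Real.sin (2 * Real.pi * (m : ℝ) ^ 2 * x) / (m : ℝ) ^ 3

/-- The limit `G(x)` of `G(x, v)` as `v → ∞`. -/
def G (x : ℝ) : ℝ := limUnder atTop (GPartial x)

/-- The function `H(x) = (1/(πx)) ∑_{m ≥ 1} sin(2πm²x)/m³ - log(1/x)`
(the series is absolutely convergent). -/
def H (x : ℝ) : ℝ :=
  1 / (Real.pi * x) *
      ∑' m : ℕ, Real.sin (2 * Real.pi * ((m : ℝ) + 1) ^ 2 * x) / ((m : ℝ) + 1) ^ 3 -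
    logInv x

end

end RivoalRoques

open Filter Topology Set

namespace RivoalRoques

/-! ### Elementary estimates -/

/-! The definition of `GPartial` and the 1-periodicity of `Ψ(·, v)` give `Ψ(x, v) = x Ψ({1/x}, xv) +
remainder x v`. Iterated along the Gauss map, this stops once `β_{k-1} v < 1` and writes `Ψ(x, v)`
as the sum of `β_{j-1} remainder (α_j) (β_{j-1} v)` (`hasSum_remainder`). For `0 < x < 1`
irrational, the remainder tends to `(H + G)(x) + log(1/x)` and lies between `-45` and `47 +
log(1/x)` for all `v ≥ 0`. As `∑ β_{j-1} ≤ 8`, dominated convergence evaluates `Ψ` at Brjuno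
numbers, and the lower bound gives the converse in the manner of Fatou's lemma.

The bounds come from two estimates. For `G`, each cotangent is replaced by its nearest pole. The
pole `0` gives the explicit sine sum; a pair `(n, m)`, with `m` nearest to `nx` and `n` nearest to
`m/x`, occurs in both `Ψ(x)` and `x Ψ(1/x)` and almost cancels (`abs_poleTerm_sub_le`); all other
contributions are summable with absolute bounds. For the sine sum, the terms resemble `2/m` up to `m
= x^(-1/2)` and then decay, so the sum is `log(1/x) + O(1)` (`sum_abs_sineTerm_sub_le`). -/

theorem abs_cot_sub_inv_le_of_pos {t : ℝ} (h0 : 0 < t) (h1 : t ≤ Real.pi / 2) :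
    |Real.cot t - 1 / t| ≤ 2 := by
  have hsin : 2 / Real.pi * t ≤ Real.sin t := Real.mul_le_sin h0.le h1
  have hpi := Real.pi_gt_three
  have hpi4 := Real.pi_le_four
  have hs0 : 0 < Real.sin t := Real.sin_pos_of_pos_of_lt_pi h0 (by linarith)
  have hsle : Real.sin t ≤ t := Real.sin_le h0.le
  have hcos : 1 - t ^ 2 / 2 ≤ Real.cos t := Real.one_sub_sq_div_two_le_cos
  have hlow : t * Real.cos t ≤ Real.sin t := by
    rcases h1.lt_or_eq with h | h
    · have hc : 0 < Real.cos t := Real.cos_pos_of_mem_Ioo ⟨by linarith, h⟩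
      have := Real.lt_tan h0 h
      rw [Real.tan_eq_sin_div_cos, lt_div_iff₀ hc] at this
      exact this.le
    · rw [h, Real.cos_pi_div_two, mul_zero, Real.sin_pi_div_two]; norm_num
  have hs1 : t / 2 ≤ Real.sin t := by
    refine le_trans ?_ hsin
    rw [div_mul_eq_mul_div, div_le_div_iff₀ (by norm_num) Real.pi_pos]
    nlinarith
  have heq : Real.cot t - 1 / t = -((Real.sin t - t * Real.cos t) / (t * Real.sin t)) := by
    rw [Real.cot_eq_cos_div_sin]; field_simp; ring
  rw [heq, abs_neg, abs_of_nonneg (div_nonneg (by linarith) (by positivity)),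
    div_le_iff₀ (by positivity)]
  -- The numerator is at most `t³/2` and the denominator at least `t²/2`, so the quotient is at most
  -- `t ≤ π/2 ≤ 2`.
  have h3 : Real.sin t - t * Real.cos t ≤ t * (t ^ 2 / 2) := by
    nlinarith [mul_le_mul_of_nonneg_left hcos h0.le]
  have h4 : t ≤ 2 := by linarith
  nlinarith [mul_le_mul_of_nonneg_left hs1 h0.le, mul_nonneg h0.le h0.le,
    mul_nonneg (mul_nonneg h0.le h0.le) (sub_nonneg.2 h4)]

theorem abs_cot_sub_inv_le {t : ℝ} (h0 : t ≠ 0) (h1 : |t| ≤ Real.pi / 2) :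
    |Real.cot t - 1 / t| ≤ 2 := by
  rcases h0.lt_or_gt with h | h
  · have := abs_cot_sub_inv_le_of_pos (t := -t) (by linarith) (by rwa [abs_of_neg h] at h1)
    have e : Real.cot (-t) - 1 / -t = -(Real.cot t - 1 / t) := by
      rw [Real.cot_eq_cos_div_sin, Real.cot_eq_cos_div_sin, Real.cos_neg, Real.sin_neg,
        div_neg, div_neg]
      ring
    rwa [e, abs_neg] at this
  · exact abs_cot_sub_inv_le_of_pos h (by rwa [abs_of_pos h] at h1)

theorem cot_add_int_mul_pi (t : ℝ) (m : ℤ) : Real.cot (t + m * Real.pi) = Real.cot t := by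
  rw [Real.cot_eq_cos_div_sin, Real.cot_eq_cos_div_sin, Real.cos_add_int_mul_pi,
    Real.sin_add_int_mul_pi, mul_div_mul_left]
  exact zpow_ne_zero _ (by norm_num)

theorem sum_Icc_inv_sq_tail_le {y : ℝ} (hy : 0 < y) (N : ℕ) :
    ∑ n ∈ Finset.Icc 1 N, (if y ≤ n then 1 / (n : ℝ) ^ 2 else 0) ≤ 2 / y := by
  rw [← Finset.sum_filter]
  have hc : 1 ≤ ⌈y⌉₊ := Nat.one_le_ceil_iff.2 hy
  calc ∑ n ∈ (Finset.Icc 1 N).filter (fun n : ℕ => y ≤ (n : ℝ)), 1 / (n : ℝ) ^ 2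
      ≤ ∑ n ∈ Finset.Ioo (⌈y⌉₊ - 1) (N + 1), ((n : ℝ) ^ 2)⁻¹ := by
        simp only [one_div]
        refine Finset.sum_le_sum_of_subset_of_nonneg ?_ fun _ _ _ => by positivity
        intro n hn
        rw [Finset.mem_filter, Finset.mem_Icc] at hn
        have := Nat.ceil_le.2 hn.2
        rw [Finset.mem_Ioo]; omega
    _ ≤ 2 / (((⌈y⌉₊ - 1 : ℕ) : ℝ) + 1) := sum_Ioo_inv_sq_le _ _
    _ ≤ 2 / y := by
        have : (((⌈y⌉₊ - 1 : ℕ) : ℝ) + 1) = ⌈y⌉₊ := by exact_mod_cast Nat.sub_add_cancel hc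
        rw [this]
        exact div_le_div_of_nonneg_left (by norm_num) hy (Nat.le_ceil y)

theorem sum_Icc_inv_sq_le (N : ℕ) : ∑ n ∈ Finset.Icc 1 N, 1 / (n : ℝ) ^ 2 ≤ 2 := by
  refine le_trans (le_of_eq (Finset.sum_congr rfl fun n hn => ?_))
    ((sum_Icc_inv_sq_tail_le one_pos N).trans (by norm_num))
  rw [if_pos]
  exact_mod_cast (Finset.mem_Icc.1 hn).1

theorem sum_Icc_one_eq_sum_range (g : ℕ → ℝ) (N : ℕ) :
    ∑ n ∈ Finset.Icc 1 N, g n = ∑ n ∈ Finset.range N, g (n + 1) := by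
  rw [Finset.range_eq_Ico, Finset.sum_Ico_add' g 0 N 1]
  rfl

theorem exists_tendsto_sum_Icc {g : ℕ → ℝ} {C : ℝ}
    (h : ∀ N, ∑ n ∈ Finset.Icc 1 N, |g n| ≤ C) :
    ∃ l, Tendsto (fun N : ℕ => ∑ n ∈ Finset.Icc 1 N, g n) atTop (𝓝 l) := by
  have hs : Summable fun n => g (n + 1) := by
    refine Summable.of_abs (summable_of_sum_range_le (c := C) (fun _ => abs_nonneg _) fun N => ?_)
    rw [← sum_Icc_one_eq_sum_range (fun n => |g n|)]
    exact h N
  refine ⟨_, hs.hasSum.tendsto_sum_nat.congr fun N => ?_⟩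
  rw [sum_Icc_one_eq_sum_range]

/-! ### Principal parts of the terms -/

/-- The term `sin(2πn²x) cot(πnx) / n²` of the series `Ψ(x)`. -/
noncomputable def psiTerm (x : ℝ) (n : ℕ) : ℝ :=
  Real.sin (2 * Real.pi * (n : ℝ) ^ 2 * x) * Real.cot (Real.pi * (n : ℝ) * x) / (n : ℝ) ^ 2

/-- The term `sin(2πn²x) / (πxn³)`. -/
noncomputable def sineTerm (x : ℝ) (n : ℕ) : ℝ :=
  Real.sin (2 * Real.pi * (n : ℝ) ^ 2 * x) / (Real.pi * x * (n : ℝ) ^ 3)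

/-- The contribution of the pole `m` of `π cot(π ·)` to the `n`-th term of `Ψ(x)`. -/
noncomputable def poleTerm (x n m : ℝ) : ℝ :=
  Real.sin (2 * Real.pi * n * (n * x - m)) / (Real.pi * n ^ 2 * (n * x - m))

/-- The arguments differ by `2πnm`. In the new form the sine is small whenever `nx - m` is, which
tames the pole. -/
theorem sin_sq_eq_sin_dist (x : ℝ) (n : ℕ) (m : ℤ) :
    Real.sin (2 * Real.pi * (n : ℝ) ^ 2 * x) = Real.sin (2 * Real.pi * n * (n * x - m)) := by
  rw [← Real.sin_add_int_mul_two_pi (2 * Real.pi * n * (n * x - m)) (n * m)]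
  congr 1; push_cast; ring

theorem mul_sub_int_ne_zero {x : ℝ} (hx : Irrational x) {n : ℕ} (hn : 1 ≤ n) (m : ℤ) :
    (n : ℝ) * x - m ≠ 0 := by
  rw [sub_ne_zero]
  exact (hx.natCast_mul (by omega)).ne_int m

theorem abs_psiTerm_sub_poleTerm_le {x : ℝ} (hx : Irrational x) {n : ℕ} (hn : 1 ≤ n) :
    |psiTerm x n - poleTerm x n (round ((n : ℝ) * x))| ≤ 2 / (n : ℝ) ^ 2 := by
  set m := round ((n : ℝ) * x)
  set d := (n : ℝ) * x - m with hd
  have hd0 : d ≠ 0 := mul_sub_int_ne_zero hx hn m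
  have hd1 : |d| ≤ 1 / 2 := abs_sub_round _
  have hn0 : (0 : ℝ) < n := by exact_mod_cast hn
  have hpi := Real.pi_pos
  have hcot : Real.cot (Real.pi * n * x) = Real.cot (Real.pi * d) := by
    rw [← cot_add_int_mul_pi (Real.pi * d) m]
    congr 1; rw [hd]; ring
  have e : psiTerm x n - poleTerm x n m =
      Real.sin (2 * Real.pi * n * d) * (Real.cot (Real.pi * d) - 1 / (Real.pi * d)) /
        (n : ℝ) ^ 2 := by
    rw [psiTerm, poleTerm, sin_sq_eq_sin_dist x n m, hcot, ← hd]
    field_simp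
  rw [e, abs_div, abs_mul, abs_of_pos (by positivity : (0 : ℝ) < (n : ℝ) ^ 2)]
  gcongr
  have h1 := Real.abs_sin_le_one (2 * Real.pi * n * d)
  have h2 : |Real.cot (Real.pi * d) - 1 / (Real.pi * d)| ≤ 2 := by
    refine abs_cot_sub_inv_le (mul_ne_zero hpi.ne' hd0) ?_
    rw [abs_mul, abs_of_pos hpi]
    nlinarith
  nlinarith [abs_nonneg (Real.cot (Real.pi * d) - 1 / (Real.pi * d))]

theorem abs_poleTerm_le {x n m : ℝ} (hn : 0 < n) : |poleTerm x n m| ≤ 2 / n := by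
  rw [poleTerm]
  by_cases hd : n * x - m = 0
  · rw [hd]; simp; positivity
  have hd' := abs_pos.2 hd
  have hpi := Real.pi_pos
  rw [abs_div, abs_mul, abs_of_pos (by positivity : 0 < Real.pi * n ^ 2),
    div_le_div_iff₀ (by positivity) hn]
  have h := Real.abs_sin_le_abs (x := 2 * Real.pi * n * (n * x - m))
  rw [abs_mul, abs_of_pos (by positivity : 0 < 2 * Real.pi * n)] at h
  nlinarith

/-- The contributions of a pair `(n, m)` with `n` the integer nearest to `m / x` to `Ψ(x)` and to
`x Ψ(1/x)` almost cancel. -/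
theorem abs_poleTerm_sub_le {x n m : ℝ} (hx0 : 0 < x) (hx1 : x < 1) (hm : 1 ≤ m) (hmn : m ≤ n)
    (hd0 : n * x - m ≠ 0) (hd1 : |n * x - m| ≤ x / 2) :
    |poleTerm x n m - x * poleTerm (1 / x) m n| ≤ 2 / m ^ 2 := by
  have hm0 : 0 < m := by linarith
  have hn0 : 0 < n := by linarith
  have hpi := Real.pi_pos
  have hpi3 := Real.pi_gt_three
  obtain ⟨d, hd⟩ : ∃ d, d = n * x - m := ⟨_, rfl⟩
  rw [← hd] at hd0 hd1
  have hdp := abs_pos.2 hd0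
  set A := 2 * Real.pi * n * d with hA
  set B := 2 * Real.pi * m * d / x with hB
  have hAB : A - B = 2 * Real.pi * d ^ 2 / x := by
    have : n = (m + d) / x := by rw [hd]; field_simp; ring
    rw [hA, hB, this]; ring
  have e1 : poleTerm x n m = Real.sin A / (Real.pi * n ^ 2 * d) := by
    rw [poleTerm, ← hd]
  have e2 : x * poleTerm (1 / x) m n = x ^ 2 * Real.sin B / (Real.pi * m ^ 2 * d) := by
    have h1 : m * (1 / x) - n = -(d / x) := by rw [hd]; field_simp; ring
    have h2 : 2 * Real.pi * m * -(d / x) = -B := by rw [hB]; ring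
    rw [poleTerm, h1, h2, Real.sin_neg]
    field_simp
  -- In the first part the phases differ by only `2πd²/x` with `|d| ≤ x/2`. In the second, `m² -
  -- n²x²` contains a factor `d` that cancels the small denominator.
  have e3 : poleTerm x n m - x * poleTerm (1 / x) m n =
      (Real.sin A - Real.sin B) / (Real.pi * n ^ 2 * d) -
        Real.sin B * (m + n * x) / (Real.pi * n ^ 2 * m ^ 2) := by
    rw [e1, e2]
    field_simp
    have : m ^ 2 - n ^ 2 * x ^ 2 = -(d * (m + n * x)) := by rw [hd]; ring
    linear_combination Real.sin B * this
  have b1 : |(Real.sin A - Real.sin B) / (Real.pi * n ^ 2 * d)| ≤ 1 / m ^ 2 := by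
    have h := Real.abs_sin_sub_sin_le A B
    rw [hAB, abs_of_nonneg (by positivity : 0 ≤ 2 * Real.pi * d ^ 2 / x)] at h
    rw [abs_div, abs_mul, abs_of_pos (by positivity : 0 < Real.pi * n ^ 2)]
    calc |Real.sin A - Real.sin B| / (Real.pi * n ^ 2 * |d|)
        ≤ (2 * Real.pi * d ^ 2 / x) / (Real.pi * n ^ 2 * |d|) := by gcongr
      _ = 2 * |d| / (x * n ^ 2) := by rw [← sq_abs d]; field_simp
      _ ≤ x / (x * n ^ 2) := by gcongr; linarith
      _ = 1 / n ^ 2 := by field_simp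
      _ ≤ 1 / m ^ 2 := by gcongr
  have b2 : |Real.sin B * (m + n * x) / (Real.pi * n ^ 2 * m ^ 2)| ≤ 1 / m ^ 2 := by
    have hs := Real.abs_sin_le_one B
    have hnx : n * x ≤ m + 1 / 2 := by
      have := (abs_le.1 hd1).2
      linarith
    have hp : 0 < m + n * x := by positivity
    rw [abs_div, abs_mul, abs_of_pos hp, abs_of_pos (by positivity :
      0 < Real.pi * n ^ 2 * m ^ 2), div_le_div_iff₀ (by positivity) (by positivity)]
    have h1 : |Real.sin B| * (m + n * x) ≤ 3 * m := by nlinarith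
    have h2 : 3 * m ≤ Real.pi * n ^ 2 := by nlinarith
    calc |Real.sin B| * (m + n * x) * m ^ 2 ≤ (Real.pi * n ^ 2) * m ^ 2 :=
          mul_le_mul_of_nonneg_right (h1.trans h2) (by positivity)
      _ = _ := by ring
  rw [e3]
  calc _ ≤ _ := abs_sub _ _
    _ ≤ 1 / m ^ 2 + 1 / m ^ 2 := add_le_add b1 b2
    _ = 2 / m ^ 2 := by ring

/-! ### The remainder `G(x, v)` -/

/-- The contribution to `Ψ(x)` of the pairs `(n, m)`, `m ≥ 1`, for which `m` is the integer nearest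
to `n x` and `n` is the integer nearest to `m / x`. -/
noncomputable def matchedTerm (x : ℝ) (n : ℕ) : ℝ :=
  if 1 ≤ round ((n : ℝ) * x) ∧ round ((round ((n : ℝ) * x) : ℝ) * (1 / x)) = n then
    poleTerm x n (round ((n : ℝ) * x)) else 0

/-- This is the source of the explicit sine sum subtracted in `GPartial`. -/
theorem poleTerm_zero (x : ℝ) (n : ℕ) : poleTerm x n 0 = sineTerm x n := by
  rw [poleTerm, sineTerm, sub_zero]
  congr 1
  · congr 1; ring
  · ring

/-- If the nearest integer `m` to `nx` is `0`, the pole term is the sine term. If `m ≥ 1`, then `nx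
≥ 1/2` makes the sine term at most `1/n²`; an unmatched pair moreover has `|nx - m| ≥ x/2`, hence a
pole term at most `1/(xn²)`. The cut-off `n ≥ 1/(2x)` pays for the factor `1/x` on summation. -/
theorem abs_psiTerm_sub_matchedTerm_le {x : ℝ} (hx : Irrational x) (hx0 : 0 < x)
    {n : ℕ} (hn : 1 ≤ n) :
    |psiTerm x n - sineTerm x n - matchedTerm x n| ≤
      3 / (n : ℝ) ^ 2 + 1 / x * (if 1 / (2 * x) ≤ n then 1 / (n : ℝ) ^ 2 else 0) := by
  have hpole := abs_psiTerm_sub_poleTerm_le hx hn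
  have hn0 : (0 : ℝ) < n := by exact_mod_cast hn
  have hpi := Real.pi_gt_three
  have hr := abs_le.1 (abs_sub_round ((n : ℝ) * x))
  have hd0 := mul_sub_int_ne_zero hx hn (round ((n : ℝ) * x))
  rw [matchedTerm]
  generalize round ((n : ℝ) * x) = m at *
  have hite : 0 ≤ 1 / x * (if 1 / (2 * x) ≤ n then 1 / (n : ℝ) ^ 2 else 0) := by
    split_ifs <;> positivity
  have h23 : 2 / (n : ℝ) ^ 2 + 1 / (n : ℝ) ^ 2 = 3 / (n : ℝ) ^ 2 := by ring
  have hsq : 0 < 1 / (n : ℝ) ^ 2 := by positivity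
  by_cases hm : 1 ≤ m
  · have hm' : (1 : ℝ) ≤ m := by exact_mod_cast hm
    have hnx : 1 / 2 ≤ (n : ℝ) * x := by linarith
    have hsine : |sineTerm x n| ≤ 1 / (n : ℝ) ^ 2 := by
      rw [sineTerm, abs_div, abs_of_pos (by positivity : 0 < Real.pi * x * (n : ℝ) ^ 3)]
      refine div_le_div₀ zero_le_one (Real.abs_sin_le_one _) (by positivity) ?_
      nlinarith [mul_pos hn0 hn0, mul_nonneg (mul_pos hn0 hn0).le (sub_nonneg.2 hnx)]
    by_cases hmn : round ((m : ℝ) * (1 / x)) = n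
    · rw [if_pos ⟨hm, hmn⟩]
      have : psiTerm x n - sineTerm x n - poleTerm x n m =
        (psiTerm x n - poleTerm x n m) - sineTerm x n := by ring
      rw [this]
      have := abs_sub (psiTerm x n - poleTerm x n m) (sineTerm x n)
      linarith
    · rw [if_neg fun h => hmn h.2, sub_zero]
      have hcond : 1 / (2 * x) ≤ n := by
        rw [div_le_iff₀ (by positivity)]; linarith
      rw [if_pos hcond]
      have hd : x / 2 ≤ |(n : ℝ) * x - m| := by
        by_contra! hlt
        obtain ⟨h1, h2⟩ := abs_lt.1 hlt
        apply hmn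
        rw [round_eq_iff, mem_Ico, mul_one_div, le_div_iff₀ hx0, div_lt_iff₀ hx0]
        push_cast
        constructor <;> linarith
      have hpb : |poleTerm x n m| ≤ 1 / x * (1 / (n : ℝ) ^ 2) := by
        rw [poleTerm, abs_div, abs_mul, abs_of_pos (by positivity : 0 < Real.pi * (n : ℝ) ^ 2),
          one_div_mul_one_div]
        refine div_le_div₀ zero_le_one (Real.abs_sin_le_one _) (by positivity) ?_
        have : x ≤ Real.pi * |(n : ℝ) * x - m| := by nlinarith
        nlinarith [mul_pos hn0 hn0]
      have h1 := abs_sub (psiTerm x n - poleTerm x n m) (sineTerm x n)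
      have h2 := abs_add_le (psiTerm x n - poleTerm x n m - sineTerm x n) (poleTerm x n m)
      have : psiTerm x n - sineTerm x n =
        psiTerm x n - poleTerm x n m - sineTerm x n + poleTerm x n m := by ring
      rw [this]
      linarith
  · have hm0 : m = 0 := by
      have : (0 : ℝ) < n * x := by positivity
      have h1 : (-1 : ℝ) < m := by linarith
      have h2 : -1 < m := by exact_mod_cast h1
      omega
    rw [if_neg fun h => hm h.1, sub_zero, ← poleTerm_zero]
    rw [hm0, Int.cast_zero] at hpole
    linarith

theorem sum_abs_psiTerm_sub_matchedTerm_le {x : ℝ} (hx : Irrational x) (hx0 : 0 < x) (N : ℕ) :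
    ∑ n ∈ Finset.Icc 1 N, |psiTerm x n - sineTerm x n - matchedTerm x n| ≤ 10 := by
  calc _ ≤ ∑ n ∈ Finset.Icc 1 N, (3 * (1 / (n : ℝ) ^ 2) +
          1 / x * (if 1 / (2 * x) ≤ n then 1 / (n : ℝ) ^ 2 else 0)) := by
        refine Finset.sum_le_sum fun n hn => ?_
        rw [mul_one_div]
        exact abs_psiTerm_sub_matchedTerm_le hx hx0 (Finset.mem_Icc.1 hn).1
    _ ≤ 3 * 2 + 1 / x * (2 / (1 / (2 * x))) := by
        rw [Finset.sum_add_distrib, ← Finset.mul_sum, ← Finset.mul_sum]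
        gcongr
        · exact sum_Icc_inv_sq_le N
        · exact sum_Icc_inv_sq_tail_le (by positivity) N
    _ = 10 := by field_simp; norm_num

/-- The integer nearest to `m / x`. -/
noncomputable def partner (x : ℝ) (m : ℕ) : ℤ := round ((m : ℝ) * (1 / x))

theorem abs_partner_mul_sub_le {x : ℝ} (hx0 : 0 < x) (m : ℕ) :
    |(partner x m : ℝ) * x - m| ≤ x / 2 := by
  have h := abs_sub_round ((m : ℝ) * (1 / x))
  have e : (partner x m : ℝ) * x - m = -(x * (m * (1 / x) - partner x m)) := by
    field_simp; ring
  rw [e, abs_neg, abs_mul, abs_of_pos hx0]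
  unfold partner
  nlinarith

theorem le_partner {x : ℝ} (hx0 : 0 < x) (hx1 : x < 1) (m : ℕ) : (m : ℤ) ≤ partner x m := by
  have h := (abs_le.1 (abs_sub_round ((m : ℝ) * (1 / x)))).2
  have h1 : (m : ℝ) ≤ m * (1 / x) := by
    rw [mul_one_div, le_div_iff₀ hx0]
    nlinarith [(Nat.cast_nonneg m : (0 : ℝ) ≤ m)]
  have h2 : (m : ℝ) < (partner x m : ℝ) + 1 := by unfold partner; linarith
  have h3 : (m : ℤ) < partner x m + 1 := by exact_mod_cast h2
  omega

theorem round_partner_mul {x : ℝ} (hx0 : 0 < x) (hx1 : x < 1) (m : ℕ) :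
    round ((partner x m : ℝ) * x) = m := by
  have h := abs_le.1 (abs_partner_mul_sub_le hx0 m)
  rw [round_eq_iff, mem_Ico]
  push_cast
  constructor <;> linarith

/-- Since `x < 1`, each `m ≥ 1` is matched with `partner x m`, and `partner x m ≤ N` means `m/x < N
+ 1/2`. -/
theorem sum_matchedTerm {x : ℝ} (hx : Irrational x) (hx0 : 0 < x) (hx1 : x < 1) (N : ℕ) :
    ∑ n ∈ Finset.Icc 1 N, matchedTerm x n =
      ∑ m ∈ Finset.Icc 1 ⌊x * (N + 1 / 2)⌋₊, poleTerm x (partner x m) m := by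
  unfold matchedTerm
  rw [← Finset.sum_filter]
  have hM : ∀ m : ℕ, m ≤ ⌊x * ((N : ℝ) + 1 / 2)⌋₊ ↔ (m : ℝ) ≤ x * (N + 1 / 2) := fun m =>
    Nat.le_floor_iff (by positivity)
  refine Finset.sum_nbij' (fun n => (round ((n : ℝ) * x)).toNat) (fun m => (partner x m).toNat)
    ?_ ?_ ?_ ?_ ?_
  · intro n hn
    obtain ⟨h1, h2, h3⟩ := Finset.mem_filter.1 hn
    obtain ⟨m, hm⟩ := Int.eq_ofNat_of_zero_le (by omega : 0 ≤ round ((n : ℝ) * x))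
    simp only [hm, Int.toNat_natCast, Finset.mem_Icc] at *
    refine ⟨by exact_mod_cast h2, (hM m).2 ?_⟩
    rw [round_eq_iff, mem_Ico, mul_one_div, div_lt_iff₀ hx0] at h3
    push_cast at h3
    have : (n : ℝ) ≤ N := by exact_mod_cast h1.2
    nlinarith [h3.2]
  · intro m hm
    rw [Finset.mem_Icc, hM] at hm
    have hle := le_partner hx0 hx1 m
    have hr := round_partner_mul hx0 hx1 m
    have hp : round ((m : ℝ) * (1 / x)) = partner x m := rfl
    have hup : partner x m ≤ N := by
      rw [partner, round_eq, ← Int.lt_add_one_iff, Int.floor_lt]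
      push_cast
      -- Irrationality excludes the tie, which `round` would send up to `N + 1`.
      have hne : (m : ℝ) ≠ x * (N + 1 / 2) := by
        have h2 := hx.ratCast_mul (q := (N : ℚ) + 1 / 2) (by positivity)
        intro h
        apply h2.ne_nat m
        rw [h]; push_cast; ring
      have : (m : ℝ) * (1 / x) < N + 1 / 2 := by
        rw [mul_one_div, div_lt_iff₀ hx0, mul_comm]
        exact lt_of_le_of_ne hm.2 hne
      linarith
    obtain ⟨n, hn⟩ := Int.eq_ofNat_of_zero_le (by omega : 0 ≤ partner x m)
    simp only [hn, Int.toNat_natCast, Finset.mem_filter, Finset.mem_Icc, Int.cast_natCast] at *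
    rw [hr]
    refine ⟨by omega, by omega, ?_⟩
    rw [Int.cast_natCast, hp]
  · intro n hn
    obtain ⟨h1, h2, h3⟩ := Finset.mem_filter.1 hn
    obtain ⟨m, hm⟩ := Int.eq_ofNat_of_zero_le (by omega : 0 ≤ round ((n : ℝ) * x))
    rw [hm, Int.cast_natCast] at h3
    simp only [hm, Int.toNat_natCast, partner, h3]
  · intro m hm
    have hle := le_partner hx0 hx1 m
    have hr := round_partner_mul hx0 hx1 m
    obtain ⟨n, hn⟩ := Int.eq_ofNat_of_zero_le (by omega : 0 ≤ partner x m)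
    rw [hn, Int.cast_natCast] at hr
    simp only [hn, Int.toNat_natCast, hr]
  · intro n hn
    obtain ⟨h1, h2, h3⟩ := Finset.mem_filter.1 hn
    obtain ⟨m, hm⟩ := Int.eq_ofNat_of_zero_le (by omega : 0 ≤ round ((n : ℝ) * x))
    rw [hm, Int.cast_natCast] at h3
    simp only [hm, Int.toNat_natCast, partner, h3, Int.cast_natCast]

theorem sum_abs_partner_sub_le {x : ℝ} (hx : Irrational x) (hx0 : 0 < x) (hx1 : x < 1) (N : ℕ) :
    ∑ m ∈ Finset.Icc 1 N,
      |poleTerm x (partner x m) m - x * poleTerm (1 / x) m (partner x m)| ≤ 4 := by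
  calc _ ≤ ∑ m ∈ Finset.Icc 1 N, 2 * (1 / (m : ℝ) ^ 2) := by
        refine Finset.sum_le_sum fun m hm => ?_
        have h1 := (Finset.mem_Icc.1 hm).1
        have hle := le_partner hx0 hx1 m
        rw [mul_one_div]
        refine abs_poleTerm_sub_le hx0 hx1 (by exact_mod_cast h1) (by exact_mod_cast hle) ?_
          (abs_partner_mul_sub_le hx0 m)
        rw [sub_ne_zero]
        exact (hx.intCast_mul (by omega)).ne_nat m
    _ ≤ 2 * 2 := by
        rw [← Finset.mul_sum]
        gcongr
        exact sum_Icc_inv_sq_le N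
    _ = 4 := by norm_num

theorem sum_abs_psiTerm_sub_poleTerm_le {x : ℝ} (hx : Irrational x) (N : ℕ) :
    ∑ m ∈ Finset.Icc 1 N, |psiTerm x m - poleTerm x m (round ((m : ℝ) * x))| ≤ 4 := by
  calc _ ≤ ∑ m ∈ Finset.Icc 1 N, 2 * (1 / (m : ℝ) ^ 2) := by
        refine Finset.sum_le_sum fun m hm => ?_
        rw [mul_one_div]
        exact abs_psiTerm_sub_poleTerm_le hx (Finset.mem_Icc.1 hm).1
    _ ≤ 2 * 2 := by
        rw [← Finset.mul_sum]
        gcongr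
        exact sum_Icc_inv_sq_le N
    _ = 4 := by norm_num

/-- At most one term is left over; the constant `4` rather than `2` covers `N = M + 1`, where that
term is bounded by `2/N`. -/
theorem abs_sum_Icc_sub_sum_Icc_le {d : ℕ → ℝ} (hd : ∀ m : ℕ, 1 ≤ m → |d m| ≤ 2 / m) {M N : ℕ}
    (h1 : M ≤ N + 1) (h2 : N ≤ M + 1) :
    |∑ m ∈ Finset.Icc 1 M, d m - ∑ m ∈ Finset.Icc 1 N, d m| ≤ 4 / ((N : ℝ) + 1) := by
  have hN : (0 : ℝ) ≤ N := Nat.cast_nonneg N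
  obtain h | h | h : M = N ∨ M = N + 1 ∨ N = M + 1 := by omega
  · rw [h, sub_self, abs_zero]; positivity
  · rw [h, Finset.sum_Icc_succ_top (by omega), add_sub_cancel_left]
    refine (hd _ (by omega)).trans ?_
    push_cast
    gcongr; norm_num
  · rw [abs_sub_comm, h, Finset.sum_Icc_succ_top (by omega), add_sub_cancel_left]
    refine (hd _ (by omega)).trans ?_
    push_cast
    have : (0 : ℝ) ≤ M := Nat.cast_nonneg M
    rw [div_le_div_iff₀ (by positivity) (by positivity)]
    linarith

theorem floor_shift_le {x v : ℝ} (hx0 : 0 < x) (hx1 : x < 1) (hv : 0 ≤ v) :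
    ⌊x * ((⌊v⌋₊ : ℝ) + 1 / 2)⌋₊ ≤ ⌊x * v⌋₊ + 1 ∧ ⌊x * v⌋₊ ≤ ⌊x * ((⌊v⌋₊ : ℝ) + 1 / 2)⌋₊ + 1 := by
  have h1 := Nat.floor_le hv
  have h2 := Nat.lt_floor_add_one v
  constructor
  · rw [← Nat.floor_add_one (by positivity)]
    exact Nat.floor_le_floor (by nlinarith)
  · rw [← Nat.floor_add_one (by positivity)]
    exact Nat.floor_le_floor (by nlinarith)

theorem psiPartial_eq (x v : ℝ) : psiPartial x v = ∑ n ∈ Finset.Icc 1 ⌊v⌋₊, psiTerm x n := rfl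

theorem sineSum_eq (x v : ℝ) :
    1 / (Real.pi * x) *
      ∑ m ∈ Finset.Icc 1 ⌊v⌋₊, Real.sin (2 * Real.pi * (m : ℝ) ^ 2 * x) / (m : ℝ) ^ 3 =
    ∑ m ∈ Finset.Icc 1 ⌊v⌋₊, sineTerm x m := by
  rw [Finset.mul_sum]
  refine Finset.sum_congr rfl fun m _ => ?_
  rw [sineTerm, ← mul_div_mul_comm, one_mul]

/-- The first three sums are partial sums of absolutely convergent series, bounded by `10`, `4` and
`4`; the last difference is a boundary effect of at most one term, since the two cut-offs in `m`
nearly agree. -/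
theorem GPartial_eq {x : ℝ} (hx : Irrational x) (hx0 : 0 < x) (hx1 : x < 1) (v : ℝ) :
    GPartial x v =
      ∑ n ∈ Finset.Icc 1 ⌊v⌋₊, (psiTerm x n - sineTerm x n - matchedTerm x n) +
      ∑ m ∈ Finset.Icc 1 ⌊x * ((⌊v⌋₊ : ℝ) + 1 / 2)⌋₊,
        (poleTerm x (partner x m) m - x * poleTerm (1 / x) m (partner x m)) -
      x * ∑ m ∈ Finset.Icc 1 ⌊x * v⌋₊, (psiTerm (1 / x) m - poleTerm (1 / x) m (partner x m)) +
      (∑ m ∈ Finset.Icc 1 ⌊x * ((⌊v⌋₊ : ℝ) + 1 / 2)⌋₊, x * poleTerm (1 / x) m (partner x m) -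
        ∑ m ∈ Finset.Icc 1 ⌊x * v⌋₊, x * poleTerm (1 / x) m (partner x m)) := by
  rw [GPartial, sineSum_eq, psiPartial_eq, psiPartial_eq]
  simp only [Finset.sum_sub_distrib, ← Finset.mul_sum]
  rw [sum_matchedTerm hx hx0 hx1]
  ring

theorem abs_partner_poleTerm_le {x : ℝ} (hx0 : 0 < x) (hx1 : x < 1) (m : ℕ) (hm : 1 ≤ m) :
    |x * poleTerm (1 / x) m (partner x m)| ≤ 2 / m := by
  have hm0 : (0 : ℝ) < m := by exact_mod_cast hm
  rw [abs_mul, abs_of_pos hx0]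
  have := abs_poleTerm_le (x := 1 / x) (m := partner x m) hm0
  nlinarith [abs_nonneg (poleTerm (1 / x) m (partner x m))]

theorem irrational_one_div {x : ℝ} (hx : Irrational x) : Irrational (1 / x) := by
  rw [one_div]; exact hx.inv

theorem abs_GPartial_le {x v : ℝ} (hx : Irrational x) (hx0 : 0 < x) (hx1 : x < 1) (hv : 0 ≤ v) :
    |GPartial x v| ≤ 22 := by
  rw [GPartial_eq hx hx0 hx1]
  have hfl := floor_shift_le hx0 hx1 hv
  have b1 := (Finset.abs_sum_le_sum_abs _ _).trans
    (sum_abs_psiTerm_sub_matchedTerm_le hx hx0 ⌊v⌋₊)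
  have b2 := (Finset.abs_sum_le_sum_abs _ _).trans
    (sum_abs_partner_sub_le hx hx0 hx1 ⌊x * ((⌊v⌋₊ : ℝ) + 1 / 2)⌋₊)
  have b3 := (Finset.abs_sum_le_sum_abs _ _).trans
    (sum_abs_psiTerm_sub_poleTerm_le (irrational_one_div hx) ⌊x * v⌋₊)
  have b4 := abs_sum_Icc_sub_sum_Icc_le (abs_partner_poleTerm_le hx0 hx1) hfl.1 hfl.2
  have b5 : 4 / ((⌊x * v⌋₊ : ℝ) + 1) ≤ 4 := by
    rw [div_le_iff₀ (by positivity)]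
    linarith [(Nat.cast_nonneg ⌊x * v⌋₊ : (0 : ℝ) ≤ _)]
  replace b4 := b4.trans b5
  simp only [← partner.eq_1] at b3
  rw [abs_le] at *
  constructor <;> nlinarith

theorem exists_tendsto_GPartial {x : ℝ} (hx : Irrational x) (hx0 : 0 < x) (hx1 : x < 1) :
    ∃ l, Tendsto (GPartial x) atTop (𝓝 l) := by
  obtain ⟨l1, h1⟩ := exists_tendsto_sum_Icc (sum_abs_psiTerm_sub_matchedTerm_le hx hx0)
  obtain ⟨l2, h2⟩ := exists_tendsto_sum_Icc (sum_abs_partner_sub_le hx hx0 hx1)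
  obtain ⟨l3, h3⟩ := exists_tendsto_sum_Icc
    (sum_abs_psiTerm_sub_poleTerm_le (irrational_one_div hx))
  have t1 : Tendsto (fun v : ℝ => ⌊v⌋₊) atTop atTop := tendsto_nat_floor_atTop
  have t2 : Tendsto (fun v : ℝ => ⌊x * v⌋₊) atTop atTop :=
    t1.comp (tendsto_id.const_mul_atTop hx0)
  have t3 : Tendsto (fun v : ℝ => ⌊x * ((⌊v⌋₊ : ℝ) + 1 / 2)⌋₊) atTop atTop :=
    t1.comp ((tendsto_atTop_add_const_right _ _
      (tendsto_natCast_atTop_atTop.comp t1)).const_mul_atTop hx0)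
  have h4 : Tendsto (fun v : ℝ => ∑ m ∈ Finset.Icc 1 ⌊x * ((⌊v⌋₊ : ℝ) + 1 / 2)⌋₊,
      x * poleTerm (1 / x) m (partner x m) -
        ∑ m ∈ Finset.Icc 1 ⌊x * v⌋₊, x * poleTerm (1 / x) m (partner x m)) atTop (𝓝 0) := by
    have h0 : Tendsto (fun v : ℝ => 4 / ((⌊x * v⌋₊ : ℝ) + 1)) atTop (𝓝 0) :=
      tendsto_const_nhds.div_atTop (tendsto_atTop_add_const_right _ _
        (tendsto_natCast_atTop_atTop.comp t2))
    refine squeeze_zero_norm' ?_ h0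
    filter_upwards [eventually_ge_atTop 0] with v hv
    have hfl := floor_shift_le hx0 hx1 hv
    exact abs_sum_Icc_sub_sum_Icc_le (abs_partner_poleTerm_le hx0 hx1) hfl.1 hfl.2
  refine ⟨_, ((((h1.comp t1).add (h2.comp t3)).sub ((h3.comp t2).const_mul x)).add h4).congr
    fun v => ?_⟩
  rw [GPartial_eq hx hx0 hx1]
  rfl

theorem tendsto_GPartial {x : ℝ} (hx : Irrational x) (hx0 : 0 < x) (hx1 : x < 1) :
    Tendsto (GPartial x) atTop (𝓝 (G x)) :=
  tendsto_nhds_limUnder (exists_tendsto_GPartial hx hx0 hx1)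

/-! ### The sum `∑ sin(2πm²x) / (πxm³)` -/

/-- For `m ≤ y = x^(-1/2)`, the cubic bound for `t - sin t` gives an error of at most `22xy` per
term, hence `22xy² = 22` in all. Beyond `y` the trivial bound on the sine leaves `2/(3xy²) ≤ 1`. -/
theorem sum_abs_sineTerm_sub_le {x y : ℝ} (hx0 : 0 < x) (hy0 : 0 < y) (hxy : y ^ 2 * x = 1)
    (N : ℕ) :
    ∑ m ∈ Finset.Icc 1 N, |sineTerm x m - (if m ≤ ⌊y⌋₊ then 2 * (m : ℝ)⁻¹ else 0)| ≤ 23 := by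
  have hpi := Real.pi_gt_three
  have hpi4 := Real.pi_le_four
  have hterm : ∀ m ∈ Finset.Icc 1 N,
      |sineTerm x m - (if m ≤ ⌊y⌋₊ then 2 * (m : ℝ)⁻¹ else 0)| ≤
        (if m ≤ ⌊y⌋₊ then 22 * x * y else 0) +
          1 / (3 * x * y) * (if y ≤ m then 1 / (m : ℝ) ^ 2 else 0) := by
    intro m hm
    have hm1 := (Finset.mem_Icc.1 hm).1
    have hm0 : (0 : ℝ) < m := by exact_mod_cast hm1
    by_cases h : m ≤ ⌊y⌋₊
    · rw [if_pos h, if_pos h]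
      have hmy : (m : ℝ) ≤ y := (Nat.le_floor_iff hy0.le).1 h
      have hite : 0 ≤ 1 / (3 * x * y) * (if y ≤ m then 1 / (m : ℝ) ^ 2 else 0) := by
        split_ifs <;> positivity
      refine le_trans ?_ (le_add_of_nonneg_right hite)
      set t := 2 * Real.pi * (m : ℝ) ^ 2 * x with ht
      have ht0 : 0 ≤ t := by positivity
      have h1 := Real.sin_le ht0
      have h2 := Real.sin_ge_sub_cube ht0
      have e : sineTerm x m - 2 * (m : ℝ)⁻¹ = -((t - Real.sin t) / (Real.pi * x * m ^ 3)) := by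
        rw [sineTerm, ← ht]
        have : 2 * (m : ℝ)⁻¹ = t / (Real.pi * x * m ^ 3) := by
          rw [ht]; field_simp
        rw [this]; ring
      rw [e, abs_neg, abs_of_nonneg (div_nonneg (by linarith) (by positivity)),
        div_le_iff₀ (by positivity)]
      have h3 : (m : ℝ) ^ 2 * x ≤ 1 := by
        rw [← hxy]; gcongr
      calc t - Real.sin t ≤ t ^ 3 / 6 := by linarith
        _ = (4 / 3 * (Real.pi * Real.pi)) * (Real.pi * x * m ^ 3) * (x * m) * (m ^ 2 * x) := by
            rw [ht]; ring
        -- With `π ≤ 4`, `(4/3)π² ≤ 64/3 < 22`.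
        _ ≤ 22 * (Real.pi * x * m ^ 3) * (x * y) * 1 := by
            gcongr
            nlinarith
        _ = _ := by ring
    · rw [if_neg h, if_neg h, sub_zero, zero_add]
      have hym : y ≤ m := by
        rw [not_le, Nat.floor_lt hy0.le] at h
        exact h.le
      rw [if_pos hym, sineTerm, abs_div,
        abs_of_pos (by positivity : 0 < Real.pi * x * (m : ℝ) ^ 3), one_div_mul_one_div]
      refine div_le_div₀ zero_le_one (Real.abs_sin_le_one _) (by positivity) ?_
      calc 3 * x * y * (m : ℝ) ^ 2 ≤ Real.pi * x * m * (m : ℝ) ^ 2 := by gcongr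
        _ = _ := by ring
  have hfl : ((⌊y⌋₊ : ℕ) : ℝ) ≤ y := Nat.floor_le hy0.le
  have hcard : ∑ m ∈ Finset.Icc 1 N, (if m ≤ ⌊y⌋₊ then 22 * x * y else 0) ≤ 22 := by
    rw [← Finset.sum_filter, Finset.sum_const, nsmul_eq_mul]
    have : ((Finset.Icc 1 N).filter (fun m => m ≤ ⌊y⌋₊)).card ≤ ⌊y⌋₊ := by
      calc _ ≤ (Finset.Icc 1 ⌊y⌋₊).card := Finset.card_le_card fun m hm => by
            rw [Finset.mem_filter, Finset.mem_Icc] at hm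
            exact Finset.mem_Icc.2 ⟨hm.1.1, hm.2⟩
        _ = ⌊y⌋₊ := by simp
    calc _ ≤ y * (22 * x * y) := by
          gcongr
          exact (Nat.cast_le.2 this).trans hfl
      _ = 22 * (y ^ 2 * x) := by ring
      _ = 22 := by rw [hxy, mul_one]
  calc _ ≤ _ := Finset.sum_le_sum hterm
    _ ≤ 22 + 1 / (3 * x * y) * (2 / y) := by
        rw [Finset.sum_add_distrib, ← Finset.mul_sum]
        gcongr
        exact sum_Icc_inv_sq_tail_le hy0 N
    _ = 22 + 2 / (3 * (y ^ 2 * x)) := by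
        congr 1; field_simp
    _ ≤ 23 := by rw [hxy]; norm_num

theorem sum_Icc_ite_eq_harmonic (M N : ℕ) :
    ∑ m ∈ Finset.Icc 1 N, (if m ≤ M then 2 * (m : ℝ)⁻¹ else 0) =
      2 * (harmonic (min N M) : ℝ) := by
  rw [← Finset.sum_filter, harmonic_eq_sum_Icc, ← Finset.mul_sum]
  push_cast
  congr 1
  refine Finset.sum_congr ?_ fun _ _ => rfl
  ext m
  simp only [Finset.mem_filter, Finset.mem_Icc]
  omega

theorem abs_sum_sineTerm_sub_harmonic_le {x y : ℝ} (hx0 : 0 < x) (hy0 : 0 < y)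
    (hxy : y ^ 2 * x = 1) (N : ℕ) :
    |∑ m ∈ Finset.Icc 1 N, sineTerm x m - 2 * (harmonic (min N ⌊y⌋₊) : ℝ)| ≤ 23 := by
  rw [← sum_Icc_ite_eq_harmonic, ← Finset.sum_sub_distrib]
  exact (Finset.abs_sum_le_sum_abs _ _).trans (sum_abs_sineTerm_sub_le hx0 hy0 hxy N)

theorem harmonic_mono {m n : ℕ} (h : m ≤ n) : harmonic m ≤ harmonic n := by
  rw [harmonic_eq_sum_Icc, harmonic_eq_sum_Icc]
  exact Finset.sum_le_sum_of_subset_of_nonneg (Finset.Icc_subset_Icc_right h)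
    fun _ _ _ => by positivity

theorem harmonic_nonneg (n : ℕ) : 0 ≤ harmonic n := by
  rw [harmonic_eq_sum_Icc]
  exact Finset.sum_nonneg fun _ _ => by positivity

theorem exists_sq_mul_eq_one {x : ℝ} (hx0 : 0 < x) (hx1 : x < 1) :
    ∃ y : ℝ, 1 ≤ y ∧ y ^ 2 * x = 1 ∧ logInv x = 2 * Real.log y := by
  refine ⟨√(1 / x), ?_, ?_, ?_⟩
  · rw [Real.one_le_sqrt, le_div_iff₀ hx0]; linarith
  · rw [Real.sq_sqrt (by positivity)]; field_simp
  · rw [logInv, Real.log_sqrt (by positivity)]; ring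

theorem logInv_nonneg {x : ℝ} (hx0 : 0 < x) (hx1 : x < 1) : 0 ≤ logInv x :=
  Real.log_nonneg (by rw [le_div_iff₀ hx0]; linarith)

/-- The absence of a logarithm, uniformly in `N`, is what later permits the Fatou-type argument. -/
theorem neg_le_sum_sineTerm {x : ℝ} (hx0 : 0 < x) (hx1 : x < 1) (N : ℕ) :
    -23 ≤ ∑ m ∈ Finset.Icc 1 N, sineTerm x m := by
  obtain ⟨y, hy, hxy, -⟩ := exists_sq_mul_eq_one hx0 hx1
  have h := (abs_le.1 (abs_sum_sineTerm_sub_harmonic_le hx0 (by linarith) hxy N)).1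
  have h2 : (0 : ℝ) ≤ harmonic (min N ⌊y⌋₊) := by exact_mod_cast harmonic_nonneg _
  linarith

theorem sum_sineTerm_le {x : ℝ} (hx0 : 0 < x) (hx1 : x < 1) (N : ℕ) :
    ∑ m ∈ Finset.Icc 1 N, sineTerm x m ≤ 25 + logInv x := by
  obtain ⟨y, hy, hxy, hlog⟩ := exists_sq_mul_eq_one hx0 hx1
  have h := (abs_le.1 (abs_sum_sineTerm_sub_harmonic_le hx0 (by linarith) hxy N)).2
  have h1 : 1 ≤ ⌊y⌋₊ := Nat.le_floor (by simpa using hy)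
  have h2 : (harmonic (min N ⌊y⌋₊) : ℝ) ≤ harmonic ⌊y⌋₊ := by
    exact_mod_cast harmonic_mono (min_le_right _ _)
  have h3 := harmonic_le_one_add_log ⌊y⌋₊
  have h4 : Real.log ⌊y⌋₊ ≤ Real.log y :=
    Real.log_le_log (by exact_mod_cast h1) (Nat.floor_le (by linarith))
  linarith

/-- Only once `N ≥ ⌊y⌋` is the harmonic sum complete and of size `log y`. -/
theorem eventually_le_sum_sineTerm {x : ℝ} (hx0 : 0 < x) (hx1 : x < 1) :
    ∀ᶠ N : ℕ in atTop, logInv x - 23 ≤ ∑ m ∈ Finset.Icc 1 N, sineTerm x m := by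
  obtain ⟨y, hy, hxy, hlog⟩ := exists_sq_mul_eq_one hx0 hx1
  filter_upwards [eventually_ge_atTop ⌊y⌋₊] with N hN
  have h := (abs_le.1 (abs_sum_sineTerm_sub_harmonic_le hx0 (by linarith) hxy N)).1
  rw [min_eq_right hN] at h
  have h3 := log_add_one_le_harmonic ⌊y⌋₊
  have h4 : Real.log y ≤ Real.log ((⌊y⌋₊ + 1 : ℕ) : ℝ) := by
    refine Real.log_le_log (by linarith) ?_
    push_cast
    exact (Nat.lt_floor_add_one y).le
  linarith

theorem tendsto_sum_sineTerm (x : ℝ) :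
    Tendsto (fun N : ℕ => ∑ m ∈ Finset.Icc 1 N, sineTerm x m) atTop (𝓝 (H x + logInv x)) := by
  have hs : Summable fun m : ℕ =>
      Real.sin (2 * Real.pi * ((m : ℝ) + 1) ^ 2 * x) / ((m : ℝ) + 1) ^ 3 := by
    have h3 : Summable fun m : ℕ => 1 / ((m : ℝ) + 1) ^ 3 := by
      have := (summable_nat_add_iff 1).2 (Real.summable_one_div_nat_pow.2 (by norm_num : 1 < 3))
      simpa using this
    refine Summable.of_norm_bounded h3 fun m => ?_
    rw [Real.norm_eq_abs, abs_div, abs_of_pos (by positivity : 0 < ((m : ℝ) + 1) ^ 3)]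
    gcongr
    exact Real.abs_sin_le_one _
  rw [H, sub_add_cancel]
  refine (hs.hasSum.tendsto_sum_nat.const_mul (1 / (Real.pi * x))).congr fun N => ?_
  rw [sum_Icc_one_eq_sum_range, Finset.mul_sum]
  refine Finset.sum_congr rfl fun m _ => ?_
  rw [sineTerm, ← mul_div_mul_comm, one_mul]
  push_cast
  rfl

theorem abs_H_le {x : ℝ} (hx0 : 0 < x) (hx1 : x < 1) : |H x| ≤ 25 := by
  have h1 := ge_of_tendsto (tendsto_sum_sineTerm x) (eventually_le_sum_sineTerm hx0 hx1)
  have h2 := le_of_tendsto' (tendsto_sum_sineTerm x) (sum_sineTerm_le hx0 hx1)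
  rw [abs_le]
  constructor <;> linarith

theorem abs_G_le {x : ℝ} (hx : Irrational x) (hx0 : 0 < x) (hx1 : x < 1) : |G x| ≤ 22 :=
  le_of_tendsto (tendsto_GPartial hx hx0 hx1).abs <| by
    filter_upwards [eventually_ge_atTop 0] with v hv
    exact abs_GPartial_le hx hx0 hx1 hv

theorem abs_H_add_G_le {x : ℝ} (hx : Irrational x) (hx0 : 0 < x) (hx1 : x < 1) :
    |(H + G) x| ≤ 47 := by
  have := abs_add_le (H x) (G x)
  have := abs_H_le hx0 hx1
  have := abs_G_le hx hx0 hx1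
  rw [Pi.add_apply]
  linarith

/-! ### The Gauss map iteration -/

theorem alpha_succ (k : ℕ) (x : ℝ) : alpha (k + 1) x = Int.fract (1 / alpha k x) := by
  rw [alpha, Function.iterate_succ_apply']
  rfl

theorem irrational_fract {x : ℝ} (hx : Irrational x) : Irrational (Int.fract x) :=
  hx.sub_intCast _

theorem irrational_alpha {x : ℝ} (hx : Irrational x) (k : ℕ) : Irrational (alpha k x) := by
  induction k with
  | zero => exact irrational_fract hx
  | succ k ih => rw [alpha_succ]; exact irrational_fract (irrational_one_div ih)

theorem alpha_pos {x : ℝ} (hx : Irrational x) (k : ℕ) : 0 < alpha k x := by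
  refine lt_of_le_of_ne ?_ (irrational_alpha hx k).ne_zero.symm
  cases k with
  | zero => exact Int.fract_nonneg _
  | succ k => rw [alpha_succ]; exact Int.fract_nonneg _

theorem alpha_lt_one (x : ℝ) (k : ℕ) : alpha k x < 1 := by
  cases k with
  | zero => exact Int.fract_lt_one _
  | succ k => rw [alpha_succ]; exact Int.fract_lt_one _

theorem betaPrev_succ (k : ℕ) (x : ℝ) : betaPrev (k + 1) x = betaPrev k x * alpha k x :=
  Finset.prod_range_succ _ _

theorem betaPrev_pos {x : ℝ} (hx : Irrational x) (k : ℕ) : 0 < betaPrev k x :=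
  Finset.prod_pos fun i _ => alpha_pos hx i

theorem alpha_mul_alpha_succ_le {x : ℝ} (hx : Irrational x) (k : ℕ) :
    alpha k x * alpha (k + 1) x ≤ 1 / 2 := by
  have h0 := alpha_pos hx k
  have h1 := alpha_lt_one x k
  have h2 := alpha_lt_one x (k + 1)
  by_cases h : alpha k x ≤ 1 / 2
  · nlinarith
  -- Here the product is `1 - α_k ⌊1/α_k⌋ ≤ 1 - α_k < 1/2`.
  · have hfl : 1 ≤ ⌊1 / alpha k x⌋ := by
      rw [Int.le_floor, le_div_iff₀ h0]; push_cast; linarith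
    have hfl' : (1 : ℝ) ≤ ⌊1 / alpha k x⌋ := by exact_mod_cast hfl
    have e : alpha k x * alpha (k + 1) x = 1 - alpha k x * ⌊1 / alpha k x⌋ := by
      rw [alpha_succ, Int.fract]; field_simp
    rw [e]
    nlinarith

/-- Two steps gain a factor `1/2 ≤ (3/4)²`. -/
theorem betaPrev_le {x : ℝ} (hx : Irrational x) (k : ℕ) :
    betaPrev k x ≤ 2 * (3 / 4 : ℝ) ^ k := by
  induction k using Nat.twoStepInduction with
  | zero => simp [betaPrev]
  | one =>
    have := alpha_lt_one x 0
    rw [betaPrev, Finset.prod_range_one]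
    linarith
  | more k h1 _ =>
    rw [betaPrev_succ, betaPrev_succ, mul_assoc]
    have := alpha_mul_alpha_succ_le hx k
    have hb := betaPrev_pos hx k
    have hp : (0 : ℝ) < (3 / 4) ^ k := by positivity
    rw [pow_add]
    nlinarith

theorem summable_betaPrev {x : ℝ} (hx : Irrational x) : Summable fun k => betaPrev k x :=
  Summable.of_nonneg_of_le (fun k => (betaPrev_pos hx k).le) (betaPrev_le hx)
    ((summable_geometric_of_lt_one (by norm_num) (by norm_num)).mul_left 2)

theorem tsum_betaPrev_le {x : ℝ} (hx : Irrational x) : ∑' k, betaPrev k x ≤ 8 := by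
  have hg : Summable fun k : ℕ => (3 / 4 : ℝ) ^ k :=
    summable_geometric_of_lt_one (by norm_num) (by norm_num)
  calc _ ≤ ∑' k : ℕ, 2 * (3 / 4 : ℝ) ^ k :=
        (summable_betaPrev hx).tsum_le_tsum (betaPrev_le hx) (hg.mul_left 2)
    _ = 8 := by
        rw [tsum_mul_left, tsum_geometric_of_lt_one (by norm_num) (by norm_num)]; norm_num

theorem betaPrev_antitone {x : ℝ} (hx : Irrational x) : Antitone fun k => betaPrev k x :=
  antitone_nat_of_succ_le fun k => by
    rw [betaPrev_succ]
    exact mul_le_of_le_one_right (betaPrev_pos hx k).le (alpha_lt_one x k).le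

theorem psiPartial_fract (x v : ℝ) : psiPartial (Int.fract x) v = psiPartial x v := by
  refine Finset.sum_congr rfl fun n _ => ?_
  have hx := Int.fract_add_floor x
  set f := Int.fract x
  set z := ⌊x⌋
  have e1 : 2 * Real.pi * (n : ℝ) ^ 2 * x =
      2 * Real.pi * (n : ℝ) ^ 2 * f + ((n ^ 2 * z : ℤ) : ℝ) * (2 * Real.pi) := by
    rw [← hx]; push_cast; ring
  have e2 : Real.pi * (n : ℝ) * x = Real.pi * (n : ℝ) * f + ((n * z : ℤ) : ℝ) * Real.pi := by
    rw [← hx]; push_cast; ring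
  rw [e1, e2, Real.sin_add_int_mul_two_pi, cot_add_int_mul_pi]

/-- The inhomogeneous term of the approximate functional equation of `Ψ(x, v)`. -/
noncomputable def remainder (x v : ℝ) : ℝ :=
  ∑ m ∈ Finset.Icc 1 ⌊v⌋₊, sineTerm x m + GPartial x v

theorem psiPartial_eq_add_remainder (x v : ℝ) :
    psiPartial x v = x * psiPartial (Int.fract (1 / x)) (x * v) + remainder x v := by
  rw [psiPartial_fract, remainder, GPartial, sineSum_eq]
  ring

theorem psiPartial_eq_sum_remainder (x v : ℝ) (k : ℕ) :
    psiPartial x v = ∑ j ∈ Finset.range k, betaPrev j x * remainder (alpha j x) (betaPrev j x * v) +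
      betaPrev k x * psiPartial (alpha k x) (betaPrev k x * v) := by
  induction k with
  | zero => simp [betaPrev, alpha, psiPartial_fract]
  | succ k ih =>
    rw [ih, Finset.sum_range_succ, psiPartial_eq_add_remainder (alpha k x), ← alpha_succ,
      betaPrev_succ, mul_comm (betaPrev k x) (alpha k x), mul_assoc (alpha k x) (betaPrev k x) v]
    ring

theorem psiPartial_of_lt_one (x : ℝ) {v : ℝ} (hv : v < 1) : psiPartial x v = 0 := by
  rw [psiPartial, Nat.floor_eq_zero.2 hv]
  simp

theorem remainder_of_lt_one {x v : ℝ} (hx1 : x < 1) (hv0 : 0 ≤ v) (hv : v < 1) :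
    remainder x v = 0 := by
  have h := psiPartial_eq_add_remainder x v
  have hxv : x * v < 1 := (mul_le_of_le_one_left hv0 hx1.le).trans_lt hv
  rw [psiPartial_of_lt_one x hv, psiPartial_of_lt_one _ hxv] at h
  linarith

/-- All terms with `β_{j-1} v < 1` vanish, so the sum is finite. Letting `j` run over all naturals
gives an index set independent of `v`, ready for `v → ∞`. -/
theorem hasSum_remainder {x v : ℝ} (hx : Irrational x) (hv : 0 ≤ v) :
    HasSum (fun j => betaPrev j x * remainder (alpha j x) (betaPrev j x * v))
      (psiPartial x v) := by
  have hlim : Tendsto (fun k => betaPrev k x * v) atTop (𝓝 0) := by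
    simpa using (summable_betaPrev hx).tendsto_atTop_zero.mul_const v
  obtain ⟨K, hK⟩ := (hlim.eventually_lt_const one_pos).exists
  rw [psiPartial_eq_sum_remainder x v K, psiPartial_of_lt_one _ hK, mul_zero, add_zero]
  refine hasSum_sum_of_ne_finset_zero fun j hj => ?_
  have hKj : K ≤ j := by simpa using hj
  rw [remainder_of_lt_one (alpha_lt_one x j)
    (mul_nonneg (betaPrev_pos hx j).le hv), mul_zero]
  exact (mul_le_mul_of_nonneg_right (betaPrev_antitone hx hKj) hv).trans_lt hK

theorem neg_le_remainder {x v : ℝ} (hx : Irrational x) (hx0 : 0 < x) (hx1 : x < 1) (hv : 0 ≤ v) :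
    -45 ≤ remainder x v := by
  have h1 := neg_le_sum_sineTerm hx0 hx1 ⌊v⌋₊
  have h2 := (abs_le.1 (abs_GPartial_le hx hx0 hx1 hv)).1
  rw [remainder]
  linarith

theorem abs_remainder_le {x v : ℝ} (hx : Irrational x) (hx0 : 0 < x) (hx1 : x < 1) (hv : 0 ≤ v) :
    |remainder x v| ≤ 47 + logInv x := by
  have h1 := neg_le_remainder hx hx0 hx1 hv
  have h2 := sum_sineTerm_le hx0 hx1 ⌊v⌋₊
  have h3 := (abs_le.1 (abs_GPartial_le hx hx0 hx1 hv)).2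
  have h4 := logInv_nonneg hx0 hx1
  rw [abs_le]
  refine ⟨by linarith, ?_⟩
  rw [remainder]
  linarith

theorem tendsto_remainder {x : ℝ} (hx : Irrational x) (hx0 : 0 < x) (hx1 : x < 1) :
    Tendsto (remainder x) atTop (𝓝 ((H + G) x + logInv x)) := by
  have h := ((tendsto_sum_sineTerm x).comp tendsto_nat_floor_atTop).add
    (tendsto_GPartial hx hx0 hx1)
  rw [Pi.add_apply, add_right_comm]
  exact h

theorem tendsto_betaPrev_mul_remainder {x : ℝ} (hx : Irrational x) (j : ℕ) :
    Tendsto (fun v => betaPrev j x * remainder (alpha j x) (betaPrev j x * v)) atTop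
      (𝓝 (seriesTerm (H + G) x j + seriesTerm logInv x j)) := by
  have h := ((tendsto_remainder (irrational_alpha hx j) (alpha_pos hx j) (alpha_lt_one x j)).comp
    (tendsto_id.const_mul_atTop (betaPrev_pos hx j))).const_mul (betaPrev j x)
  rw [mul_add] at h
  exact h

/-! ### The series `𝒮_{H+G}` and the convergence of `Ψ` -/

theorem abs_seriesTerm_H_add_G_le {x : ℝ} (hx : Irrational x) (j : ℕ) :
    |seriesTerm (H + G) x j| ≤ 47 * betaPrev j x := by
  rw [seriesTerm, abs_mul, abs_of_pos (betaPrev_pos hx j), mul_comm]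
  exact mul_le_mul_of_nonneg_right
    (abs_H_add_G_le (irrational_alpha hx j) (alpha_pos hx j) (alpha_lt_one x j))
    (betaPrev_pos hx j).le

theorem summable_seriesTerm_H_add_G {x : ℝ} (hx : Irrational x) :
    Summable (seriesTerm (H + G) x) :=
  Summable.of_norm_bounded ((summable_betaPrev hx).mul_left 47) (abs_seriesTerm_H_add_G_le hx)

theorem abs_seriesSum_H_add_G_le {x : ℝ} (hx : Irrational x) :
    |seriesSum (H + G) x| ≤ 376 := by
  have h := tsum_of_norm_bounded (f := seriesTerm (H + G) x) ((summable_betaPrev hx).mul_left 47).hasSum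
    (abs_seriesTerm_H_add_G_le hx)
  rw [tsum_mul_left] at h
  have := tsum_betaPrev_le hx
  rw [Real.norm_eq_abs] at h
  exact h.trans (by linarith)

/-- The dominating series is `47 β_{j-1} + β_{j-1} log(1/α_j)`, whose summability is the Brjuno
condition. -/
theorem tendsto_psiPartial_of_isBrjuno {x : ℝ} (hx : IsBrjuno x) :
    Tendsto (psiPartial x) atTop (𝓝 (seriesSum (H + G) x + Phi x)) := by
  obtain ⟨hx, hs⟩ := hx
  rw [seriesSum, Phi, seriesSum, ← (summable_seriesTerm_H_add_G hx).tsum_add hs]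
  have h := tendsto_tsum_of_dominated_convergence (𝓕 := atTop)
    (((summable_betaPrev hx).mul_left 47).add hs) (tendsto_betaPrev_mul_remainder hx) (by
      filter_upwards [eventually_ge_atTop 0] with v hv j
      have hb := betaPrev_pos hx j
      rw [Real.norm_eq_abs, abs_mul, abs_of_pos hb, mul_comm 47, seriesTerm, ← mul_add]
      exact mul_le_mul_of_nonneg_left (abs_remainder_le (irrational_alpha hx j) (alpha_pos hx j)
        (alpha_lt_one x j) (mul_nonneg hb.le hv)) hb.le)
  refine h.congr' ?_
  filter_upwards [eventually_ge_atTop 0] with v hv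
  exact (hasSum_remainder hx hv).tsum_eq

theorem isBrjuno_of_psiConverges {x : ℝ} (hx : Irrational x) (h : PsiConverges x) :
    IsBrjuno x := by
  obtain ⟨l, hl⟩ := h
  have hβ := summable_betaPrev hx
  -- `92 = 45 + 47`: the lower bound of the remainder and the bound of `H + G`, each weighted by `∑
  -- β_{j-1} ≤ 8`.
  refine ⟨hx, summable_of_sum_range_le (c := l + 92 * 8) (fun j => mul_nonneg
    (betaPrev_pos hx j).le (logInv_nonneg (alpha_pos hx j) (alpha_lt_one x j))) fun K => ?_⟩
  -- Adding `45 β_{j-1}` makes every summand nonnegative, so finite partial sums are at most `Ψ(x,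
  -- v) + 45 ∑ β_{j-1}`; then `v → ∞` with `K` fixed.
  have hfin : ∑ j ∈ Finset.range K, (seriesTerm (H + G) x j + seriesTerm logInv x j +
      45 * betaPrev j x) ≤ l + 45 * ∑' j, betaPrev j x := by
    refine le_of_tendsto_of_tendsto (tendsto_finsetSum _ fun j _ =>
      (tendsto_betaPrev_mul_remainder hx j).add_const _) (hl.add_const _) ?_
    filter_upwards [eventually_ge_atTop 0] with v hv
    have hsum := (hasSum_remainder hx hv).add (hβ.hasSum.mul_left 45)
    refine sum_le_hasSum _ (fun j _ => ?_) hsum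
    have hb := betaPrev_pos hx j
    have := neg_le_remainder (irrational_alpha hx j) (alpha_pos hx j) (alpha_lt_one x j)
      (mul_nonneg hb.le hv)
    nlinarith
  have hle : ∑ j ∈ Finset.range K, seriesTerm logInv x j ≤
      ∑ j ∈ Finset.range K, (seriesTerm (H + G) x j + seriesTerm logInv x j +
        45 * betaPrev j x) + ∑ j ∈ Finset.range K, 47 * betaPrev j x := by
    rw [← Finset.sum_add_distrib]
    refine Finset.sum_le_sum fun j _ => ?_
    have := (abs_le.1 (abs_seriesTerm_H_add_G_le hx j)).1
    have := betaPrev_pos hx j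
    linarith
  have hβK : ∑ j ∈ Finset.range K, betaPrev j x ≤ ∑' j, betaPrev j x :=
    hβ.sum_le_tsum _ fun j _ => (betaPrev_pos hx j).le
  have h8 := tsum_betaPrev_le hx
  rw [← Finset.mul_sum] at hle
  linarith

theorem Psi_eq {x : ℝ} (hx : IsBrjuno x) : Psi x = seriesSum (H + G) x + Phi x :=
  (tendsto_psiPartial_of_isBrjuno hx).limUnder_eq

end RivoalRoques

theorem mainTheorem6 :
    -- the convergence criterion
    (∀ x : ℝ, Irrational x →
      (RivoalRoques.PsiConverges x ↔ RivoalRoques.IsBrjuno x)) ∧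
    -- `G` is defined at every irrational of the unit interval
    (∀ x : ℝ, Irrational x → x ∈ Set.Ioo (0 : ℝ) 1 →
      Tendsto (RivoalRoques.GPartial x) atTop (𝓝 (RivoalRoques.G x))) ∧
    -- the series `𝒮_{H+G}` converges at every irrational, and its sum is bounded
    (∀ x : ℝ, Irrational x →
      Summable (RivoalRoques.seriesTerm (RivoalRoques.H + RivoalRoques.G) x)) ∧
    (∃ C : ℝ, ∀ x : ℝ, Irrational x →
      |RivoalRoques.seriesSum (RivoalRoques.H + RivoalRoques.G) x| ≤ C) ∧
    -- on Brjuno numbers, `Ψ - 𝒮_{H+G} = Φ`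
    (∀ x : ℝ, RivoalRoques.IsBrjuno x →
      RivoalRoques.Psi x - RivoalRoques.seriesSum (RivoalRoques.H + RivoalRoques.G) x =
        RivoalRoques.Phi x) ∧
    -- on Brjuno numbers, `Ψ - Φ` is bounded
    (∃ C : ℝ, ∀ x : ℝ, RivoalRoques.IsBrjuno x →
      |RivoalRoques.Psi x - RivoalRoques.Phi x| ≤ C) := by
  refine ⟨fun x hx => ⟨RivoalRoques.isBrjuno_of_psiConverges hx,
      fun h => ⟨_, RivoalRoques.tendsto_psiPartial_of_isBrjuno h⟩⟩,
    fun x hx h => RivoalRoques.tendsto_GPartial hx h.1 h.2,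
    fun x hx => RivoalRoques.summable_seriesTerm_H_add_G hx,
    ⟨376, fun x hx => RivoalRoques.abs_seriesSum_H_add_G_le hx⟩,
    fun x hx => ?_, ⟨376, fun x hx => ?_⟩⟩
  · rw [RivoalRoques.Psi_eq hx]; ring
  · rw [RivoalRoques.Psi_eq hx, add_sub_cancel_right]
    exact RivoalRoques.abs_seriesSum_H_add_G_le hx.1
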